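/- Let $A,B$ be $n\times n$ complex Hermitian matrices. For $z\in\mathbb C$ consider $A-zB$, and put $A-\infty B:=B$. Let $r=\max_{z\in\mathbb C\cup\{\infty\}}\operatorname{rank}(A-zB)$ be the normal rank of the pencil $A-zB$ (the pencil may be singular, that is, $r<n$). A point $\lambda\in\mathbb C\cup\{\infty\}$ is an eigenvalue of the pencil if $\operatorname{rank}(A-\lambda B)<r$; its geometric multiplicity is $r-\operatorname{rank}(A-\lambda B)$. The algebraic multiplicity of a real eigenvalue $t_0$ is the sum of the multiplicities of $t_0$ as a zero of those real-analytic eigenfunctions $\lambda_1(t),\dots,\lambda_n(t)$ of the Hermitian matrix $A-tB$, $t\in\mathbb R$, that are not identically zero; equivalently, it is the multiplicity of $t_0$ as a zero of their product, which is, up to sign, the lowest nonzero coefficient (a polynomial in $t$) of $\det(xI-(A-tB))$ viewed as a polynomial in $x$. For a Hermitian matrix $M$, let $n_+(M)$ and $n_-(M)$ be the numbers of its positive and negative eigenvalues, with multiplicity. For real $a<b$, let $n_{(a,b)}(A,B)$ be the number of eigenvalues of the pencil in $(a,b)$, and let $n_{\mathbb R}(A,B)$ be the number of its finite real eigenvalues,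 both counted with algebraic multiplicity. Suppose that $B$ has exactly $n-k$ positive eigenvalues, where $k\ge 0$ and $n\ge 2k$. Then: (i) If $a<b$ are real numbers, neither of which is an eigenvalue of the pencil $A-zB$, then $$n_{(a,b)}(A,B)=|n_+(A-aB)-n_+(A-bB)|+2h\quad\text{for some } h\in\{0,1,\dots,k\}.$$ (ii) Let $g_\infty=r-\operatorname{rank}B$ be the geometric multiplicity of $\infty$ (zero if $\infty$ is not an eigenvalue). Then $$|n_+(B)-n_-(B)|-g_\infty\le n_{\mathbb R}(A,B)\le n.$$ In particular, if $\infty$ is not an eigenvalue of the pencil (for instance, if $B$ is nonsingular), then $|n_+(B)-n_-(B)|\le n_{\mathbb R}(A,B)\le n$. -/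

import Mathlib

/-- The number `n₊(M)` of positive eigenvalues of a Hermitian matrix, with multiplicity. -/
noncomputable def nPos {n : ℕ} {M : Matrix (Fin n) (Fin n) ℂ} (hM : M.IsHermitian) : ℕ :=
  (Finset.univ.filter fun i => 0 < hM.eigenvalues i).card

/-- The number `n₋(M)` of negative eigenvalues of a Hermitian matrix, with multiplicity. -/
noncomputable def nNeg {n : ℕ} {M : Matrix (Fin n) (Fin n) ℂ} (hM : M.IsHermitian) : ℕ :=
  (Finset.univ.filter fun i => hM.eigenvalues i < 0).card

/-- The value `A - z B` of the pencil at a point `z` of `ℂ ∪ {∞}`, with `A - ∞ B := B`. -/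
def pencilAt {n : ℕ} (A B : Matrix (Fin n) (Fin n) ℂ) : OnePoint ℂ → Matrix (Fin n) (Fin n) ℂ
  | none => B
  | some z => A - z • B

/-- For Hermitian `A`, `B` and real `t`, the matrix `A - t B` is Hermitian. -/
theorem isHermitian_pencil {n : ℕ} {A B : Matrix (Fin n) (Fin n) ℂ}
    (hA : A.IsHermitian) (hB : B.IsHermitian) (t : ℝ) :
    (A - (t : ℂ) • B).IsHermitian := by
  refine hA.sub ?_
  rw [Matrix.IsHermitian, Matrix.conjTranspose_smul, hB.eq]
  simp

/-- The normal rank `max {rank (A - z B) : z ∈ ℂ ∪ {∞}}` of the pencil. -/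
noncomputable def normalRank {n : ℕ} (A B : Matrix (Fin n) (Fin n) ℂ) : ℕ :=
  ⨆ z : OnePoint ℂ, (pencilAt A B z).rank

/-- `z ∈ ℂ ∪ {∞}` is an eigenvalue of the (possibly singular) pencil if the rank drops at `z`. -/
def IsPencilEigenvalue {n : ℕ} (A B : Matrix (Fin n) (Fin n) ℂ) (z : OnePoint ℂ) : Prop :=
  (pencilAt A B z).rank < normalRank A B

/-- The geometric multiplicity of `z ∈ ℂ ∪ {∞}`: the rank drop at `z` (zero if `z` is not an
eigenvalue). -/
noncomputable def geomMult {n : ℕ} (A B : Matrix (Fin n) (Fin n) ℂ) (z : OnePoint ℂ) : ℕ :=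
  normalRank A B - (pencilAt A B z).rank

/-- `A - z B` as a matrix of polynomials in `z`. -/
noncomputable def pencilMatrix {n : ℕ} (A B : Matrix (Fin n) (Fin n) ℂ) :
    Matrix (Fin n) (Fin n) (Polynomial ℂ) :=
  A.map Polynomial.C - (Polynomial.X : Polynomial ℂ) • B.map Polynomial.C

/-- Up to sign, the product of those eigenfunctions of `t ↦ A - t B` that are not identically zero:
the lowest nonzero coefficient of the characteristic polynomial
`det (x I - (A - z B)) ∈ ℂ[z][x]`, which is a nonzero polynomial in `z`. -/
noncomputable def eigenfunctionProd {n : ℕ} (A B : Matrix (Fin n) (Fin n) ℂ) : Polynomial ℂ :=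
  (pencilMatrix A B).charpoly.trailingCoeff

/-- The algebraic multiplicity of a real point `t` for the Hermitian pencil `A - z B`: the sum of
the multiplicities of `t` as a zero of the eigenfunctions that are not identically zero, that is,
the multiplicity of `t` as a zero of their product. See `algMult_eq_sum_order`. -/
noncomputable def algMult {n : ℕ} (A B : Matrix (Fin n) (Fin n) ℂ) (t : ℝ) : ℕ :=
  (eigenfunctionProd A B).rootMultiplicity (t : ℂ)

/-- The number of real eigenvalues of the pencil in `S ⊆ ℝ`, counted with algebraic multiplicity. -/
noncomputable def nEig {n : ℕ} (A B : Matrix (Fin n) (Fin n) ℂ) (S : Set ℝ) : ℕ :=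
  ∑ᶠ t ∈ {t : ℝ | t ∈ S ∧ IsPencilEigenvalue A B (((t : ℂ) : OnePoint ℂ))}, algMult A B t

/-- `f 0, …, f (n-1)` are (Rellich's) analytic eigenfunctions of `t ↦ A - t B`, `t ∈ ℝ`. -/
def IsEigenfunctions {n : ℕ} (A B : Matrix (Fin n) (Fin n) ℂ) (f : Fin n → ℝ → ℝ) : Prop :=
  (∀ i, AnalyticOnNhd ℝ (f i) Set.univ) ∧
    ∀ t : ℝ, (A - (t : ℂ) • B).charpoly =
      ∏ i, (Polynomial.X - Polynomial.C ((f i t : ℝ) : ℂ))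

/-- The algebraic multiplicity is the sum of the multiplicities of the zeros of the eigenfunctions
that are not identically zero. -/
theorem algMult_eq_sum_order {n : ℕ} {A B : Matrix (Fin n) (Fin n) ℂ} {f : Fin n → ℝ → ℝ}
    (hf : IsEigenfunctions A B f) (t : ℝ) [DecidablePred fun i => f i ≠ 0] :
    algMult A B t = ∑ i with f i ≠ 0, analyticOrderNatAt (f i) t := by
  obtain ⟨hfa, hfc⟩ := hf
  set S : Finset (Fin n) := Finset.univ.filter fun i => f i ≠ 0 with hS
  set p := (pencilMatrix A B).charpoly with hp
  set m := (Finset.univ.filter fun i => ¬ f i ≠ 0).card with hm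
  have hmap : ∀ s : ℝ, p.map (Polynomial.evalRingHom (s : ℂ)) =
      Polynomial.X ^ m * ∏ i ∈ S, (Polynomial.X - Polynomial.C ((f i s : ℝ) : ℂ)) := by
    intro s
    rw [hp, ← Matrix.charpoly_map]
    have h1 : (pencilMatrix A B).map (Polynomial.evalRingHom (s : ℂ)) = A - (s : ℂ) • B := by
      ext i j; simp [pencilMatrix]; exact mul_comm _ _
    rw [h1, hfc s, ← Finset.prod_filter_mul_prod_filter_not Finset.univ (fun i => f i ≠ 0),
      mul_comm]
    congr 1
    rw [hm, Finset.prod_congr rfl (g := fun _ => Polynomial.X), Finset.prod_const]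
    intro i hi
    have : f i = 0 := by simpa using hi
    simp [this]
  have hev : ∀ (s : ℝ) (j : ℕ), (p.coeff j).eval (s : ℂ) = (Polynomial.X ^ m *
      ∏ i ∈ S, (Polynomial.X - Polynomial.C ((f i s : ℝ) : ℂ))).coeff j := by
    intro s j
    rw [← hmap s, Polynomial.coeff_map]; rfl
  have hlow : ∀ j < m, p.coeff j = 0 := by
    intro j hj
    refine Polynomial.eq_zero_of_infinite_isRoot _
      (Set.Infinite.mono ?_ (Set.infinite_range_of_injective Complex.ofReal_injective))
    rintro _ ⟨s, rfl⟩
    show (p.coeff j).eval (s : ℂ) = 0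
    rw [hev, Polynomial.coeff_X_pow_mul', if_neg (not_le.2 hj)]
  have hmid : ∀ s : ℝ, (p.coeff m).eval (s : ℂ) = ∏ i ∈ S, (-((f i s : ℝ) : ℂ)) := by
    intro s
    rw [hev, Polynomial.coeff_X_pow_mul', if_pos le_rfl, Nat.sub_self,
      Polynomial.coeff_zero_eq_eval_zero, Polynomial.eval_prod]
    simp
  have hloc : ∀ i ∈ S, ∃ g : ℝ → ℝ, AnalyticAt ℝ g t ∧ g t ≠ 0 ∧ ∀ᶠ s in nhds t,
      f i s = (s - t) ^ analyticOrderNatAt (f i) t * g s := by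
    intro i hi
    have hi' : f i ≠ 0 := by simpa [hS] using hi
    have hne : analyticOrderAt (f i) t ≠ ⊤ := by
      intro htop
      apply hi'
      rw [analyticOrderAt_eq_top] at htop
      exact (hfa i).eq_of_eventuallyEq (g := 0) (fun _ _ => analyticAt_const) htop
    have := (hfa i t (Set.mem_univ t)).analyticOrderAt_ne_top.1 hne
    exact this
  choose! g hga hgne hg using hloc
  set N := ∑ i ∈ S, analyticOrderNatAt (f i) t with hN
  have hEv : ∀ᶠ s in nhds t, (p.coeff m).eval ((s : ℝ) : ℂ) =
      (s - t) ^ N • ∏ i ∈ S, (-((g i s : ℝ) : ℂ)) := by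
    have h2 : ∀ᶠ s in nhds t, ∀ i ∈ S, f i s = (s - t) ^ analyticOrderNatAt (f i) t * g i s :=
      (Finset.eventually_all S).2 hg
    filter_upwards [h2] with s hs
    rw [hmid, hN, ← Finset.prod_pow_eq_pow_sum, Complex.real_smul, Complex.ofReal_prod,
      ← Finset.prod_mul_distrib]
    refine Finset.prod_congr rfl fun i hi => ?_
    rw [hs i hi]; push_cast; ring
  have hofReal : ∀ s : ℝ, AnalyticAt ℝ (fun x : ℝ => (x : ℂ)) s := fun s =>
    Complex.ofRealCLM.analyticAt s
  have hpoly : ∀ q : Polynomial ℂ, AnalyticAt ℝ (fun s : ℝ => q.eval (s : ℂ)) t := by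
    intro q
    induction q using Polynomial.induction_on' with
    | add a b ha hb => simpa [Pi.add_def] using ha.add hb
    | monomial k c =>
      simpa [Pi.mul_def, Pi.pow_def] using (analyticAt_const (v := c)).mul ((hofReal t).pow k)
  have hord1 : analyticOrderAt (fun s : ℝ => (p.coeff m).eval (s : ℂ)) t = N := by
    rw [(hpoly _).analyticOrderAt_eq_natCast]
    refine ⟨fun s => ∏ i ∈ S, (-((g i s : ℝ) : ℂ)), ?_, ?_, hEv⟩
    · have : ∀ i ∈ S, AnalyticAt ℝ (fun s => -((g i s : ℝ) : ℂ)) t := fun i hi =>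
        ((hofReal _).comp (hga i hi)).neg
      exact Finset.analyticAt_fun_prod S this
    · exact Finset.prod_ne_zero_iff.2 fun i hi => by simpa using hgne i hi
  have hq0 : p.coeff m ≠ 0 := by
    intro h
    have : analyticOrderAt (fun s : ℝ => (p.coeff m).eval (s : ℂ)) t = ⊤ := by
      rw [analyticOrderAt_eq_top]; simp [h]
    rw [this] at hord1
    exact ENat.natCast_ne_top _ hord1.symm
  have htr : eigenfunctionProd A B = p.coeff m := by
    have hdeg : p.natTrailingDegree = m :=
      le_antisymm (Polynomial.natTrailingDegree_le_of_ne_zero hq0)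
        (Polynomial.le_natTrailingDegree (fun h => hq0 (by simp [h])) fun j hj => hlow j hj)
    rw [eigenfunctionProd, Polynomial.trailingCoeff, ← hp, hdeg]
  have hord2 : analyticOrderAt (fun s : ℝ => (p.coeff m).eval (s : ℂ)) t =
      (algMult A B t : ℕ) := by
    rw [(hpoly _).analyticOrderAt_eq_natCast, algMult, htr]
    obtain ⟨r, hr, hr2⟩ := Polynomial.exists_eq_pow_rootMultiplicity_mul_and_not_dvd
      (p.coeff m) hq0 (t : ℂ)
    refine ⟨fun s => r.eval (s : ℂ), hpoly r, fun h => hr2 (Polynomial.dvd_iff_isRoot.2 h),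
      Filter.Eventually.of_forall fun s => ?_⟩
    conv_lhs => rw [hr]
    simp [Complex.real_smul]
  rw [hord2] at hord1
  exact_mod_cast hord1

open Filter Topology Polynomial Matrix
open scoped ComplexOrder

/-!
At a point `t` that is not an eigenvalue, `A - t B` has rank `r`, so the lowest nonzero coefficient
of its characteristic polynomial in `x`, a real polynomial in `t` of degree at most `r`, has sign
`(-1) ^ n₊(A - t B)` there. Its real roots are the real eigenvalues, whence `n_ℝ ≤ r`, and comparing
its signs at `a` and `b` gives the parity of `n_(a,b)`.

By semicontinuity of `n₊` and `n₋`, the function `t ↦ n₊(A - t B)` jumps at an eigenvalue by at most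
its geometric multiplicity, which is at most the algebraic one; adding up the jumps,
`|n₊(A - a B) - n₊(A - b B)| ≤ n_(a,b)`. As `t → -∞` and `t → ∞` the inertia of `A - t B` dominates
that of `B` and of `-B`, so the jumps to the left of `a` and to the right of `b` use up enough of
the `r` available real eigenvalues to bound `n_(a,b)` from above.
-/

theorem countP_mem_add_countP_mem {α : Type*} {S T U : Set α} [DecidablePred (· ∈ S)]
    [DecidablePred (· ∈ T)] [DecidablePred (· ∈ U)] (hST : Disjoint S T) (hU : S ∪ T = U)
    (s : Multiset α) : s.countP (· ∈ S) + s.countP (· ∈ T) = s.countP (· ∈ U) := by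
  subst hU
  have hinter : ∀ x, ¬ (x ∈ S ∧ x ∈ T) := fun x hx => Set.disjoint_left.1 hST hx.1 hx.2
  simp only [Multiset.countP_eq_card_filter, ← Multiset.card_add, Multiset.filter_add_filter,
    hinter, Multiset.filter_false, add_zero, Set.mem_union]

theorem countP_mem_le_countP_mem {α : Type*} {S T : Set α} [DecidablePred (· ∈ S)]
    [DecidablePred (· ∈ T)] (hST : S ⊆ T) (s : Multiset α) :
    s.countP (· ∈ S) ≤ s.countP (· ∈ T) := by
  simp only [Multiset.countP_eq_card_filter]
  exact Multiset.card_le_card (Multiset.monotone_filter_right s hST)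

theorem count_le_countP_mem {α : Type*} [DecidableEq α] {S : Set α} [DecidablePred (· ∈ S)]
    {c : α} (hc : c ∈ S) (s : Multiset α) : s.count c ≤ s.countP (· ∈ S) := by
  simpa [Multiset.count, eq_comm] using countP_mem_le_countP_mem (Set.singleton_subset_iff.2 hc) s

section Counts

variable {α : Type*} [LinearOrder α]

theorem countP_Iio_add_countP_Ico {a b : α} (hab : a ≤ b) (s : Multiset α) :
    s.countP (· ∈ Set.Iio a) + s.countP (· ∈ Set.Ico a b) = s.countP (· ∈ Set.Iio b) :=
  countP_mem_add_countP_mem (Set.disjoint_left.2 fun _ hx hy => hy.1.not_gt hx)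
    (Set.Iio_union_Ico_eq_Iio hab) s

theorem countP_Iic_add_countP_Ioc {a b : α} (hab : a ≤ b) (s : Multiset α) :
    s.countP (· ∈ Set.Iic a) + s.countP (· ∈ Set.Ioc a b) = s.countP (· ∈ Set.Iic b) :=
  countP_mem_add_countP_mem (Set.disjoint_left.2 fun _ hx hy => hy.1.not_ge hx)
    (Set.Iic_union_Ioc_eq_Iic hab) s

end Counts

section LocalToGlobal

variable {α : Type*} [ConditionallyCompleteLinearOrder α] [TopologicalSpace α] [OrderTopology α]
  [DenselyOrdered α]

theorem monotone_of_eventually {β : Type*} [Preorder β] {G : α → β}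
    (hG : ∀ c, ∀ᶠ t in 𝓝 c, (t ≤ c → G t ≤ G c) ∧ (c ≤ t → G c ≤ G t)) :
    Monotone G := by
  intro a b hab
  let S : Set α := {t | t ∈ Set.Icc a b ∧ G a ≤ G t}
  have haS : a ∈ S := ⟨⟨le_rfl, hab⟩, le_rfl⟩
  have hlub : IsLUB S (sSup S) := isLUB_csSup ⟨a, haS⟩ ⟨b, fun t ht => ht.1.2⟩
  set c := sSup S
  have hcS : c ∈ S := by
    obtain ⟨t, htS, ht⟩ := ((hlub.frequently_mem ⟨a, haS⟩).and_eventually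
      ((hG c).filter_mono nhdsWithin_le_nhds)).exists
    exact ⟨⟨hlub.1 haS, hlub.2 fun t ht => ht.1.2⟩, htS.2.trans (ht.1 (hlub.1 htS))⟩
  obtain hcb | hcb := hcS.1.2.eq_or_lt
  · exact hcb ▸ hcS.2
  · have : (𝓝[>] c).NeBot := nhdsGT_neBot_of_exists_gt ⟨b, hcb⟩
    obtain ⟨t, ht, hct, htb⟩ := (((hG c).filter_mono nhdsWithin_le_nhds).and
      (Ioo_mem_nhdsGT hcb)).exists
    have htS : t ∈ S := ⟨⟨hcS.1.1.trans hct.le, htb.le⟩, hcS.2.trans (ht.2 hct.le)⟩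
    exact absurd (hlub.1 htS) hct.not_ge

theorem monotone_countP_Iio_sub {f : α → ℤ} {s : Multiset α}
    (hf : ∀ c, ∀ᶠ t in 𝓝 c, f c ≤ f t ∧ f t ≤ f c + s.count c) :
    Monotone fun t => (s.countP (· ∈ Set.Iio t) : ℤ) - f t := by
  refine monotone_of_eventually fun c => ?_
  filter_upwards [hf c] with t ht
  refine ⟨fun htc => ?_, fun hct => ?_⟩
  · have := countP_Iio_add_countP_Ico htc s
    omega
  · obtain rfl | hct := hct.eq_or_lt
    · rfl
    · have := countP_Iio_add_countP_Ico hct.le s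
      have := count_le_countP_mem (Set.left_mem_Ico.2 hct) s
      omega

theorem monotone_countP_Iic_add {f : α → ℤ} {s : Multiset α}
    (hf : ∀ c, ∀ᶠ t in 𝓝 c, f c ≤ f t ∧ f t ≤ f c + s.count c) :
    Monotone fun t => (s.countP (· ∈ Set.Iic t) : ℤ) + f t := by
  refine monotone_of_eventually fun c => ?_
  filter_upwards [hf c] with t ht
  refine ⟨fun htc => ?_, fun hct => ?_⟩
  · obtain rfl | htc := htc.eq_or_lt
    · rfl
    · have := countP_Iic_add_countP_Ioc htc.le s
      have := count_le_countP_mem (Set.right_mem_Ioc.2 htc) s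
      omega
  · have := countP_Iic_add_countP_Ioc hct s
    omega

theorem abs_sub_le_countP_Ioo {f : α → ℤ} {s : Multiset α}
    (hf : ∀ c, ∀ᶠ t in 𝓝 c, f c ≤ f t ∧ f t ≤ f c + s.count c) {a b : α} (hab : a < b)
    (ha : a ∉ s) (hb : b ∉ s) : |f a - f b| ≤ s.countP (· ∈ Set.Ioo a b) := by
  have hIco : s.countP (· ∈ Set.Ico a b) = s.countP (· ∈ Set.Ioo a b) :=
    Multiset.countP_congr rfl fun x hx => by
      simp [lt_iff_le_and_ne, (ne_of_mem_of_not_mem hx ha).symm]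
  have hIoc : s.countP (· ∈ Set.Ioc a b) = s.countP (· ∈ Set.Ioo a b) :=
    Multiset.countP_congr rfl fun x hx => by
      simp [lt_iff_le_and_ne, ne_of_mem_of_not_mem hx hb]
  have hrise : f b - f a ≤ s.countP (· ∈ Set.Ioo a b) := by
    have := monotone_countP_Iio_sub hf hab.le
    have := countP_Iio_add_countP_Ico hab.le s
    grind
  have hfall : f a - f b ≤ s.countP (· ∈ Set.Ioo a b) := by
    have := monotone_countP_Iic_add hf hab.le
    have := countP_Iic_add_countP_Ioc hab.le s
    grind
  exact abs_sub_le_iff.2 ⟨hfall, hrise⟩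

end LocalToGlobal

section RealPolynomials

theorem eval_mul_eval_pos_of_forall_ne_zero {q : ℝ[X]} (hq : ∀ t, q.eval t ≠ 0) (a b : ℝ) :
    0 < q.eval a * q.eval b := by
  by_contra! h
  have hzero : (0 : ℝ) ∈ Set.uIcc (q.eval a) (q.eval b) :=
    Set.mem_uIcc.2 ((mul_nonpos_iff.1 h).symm.imp_right And.symm)
  obtain ⟨t, -, ht⟩ := intermediate_value_uIcc q.continuous.continuousOn hzero
  exact hq t ht

theorem neg_one_pow_countP_Ioo_mul_prod_sub_mul_prod_sub_pos {K : Type*} [Field K] [LinearOrder K]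
    [IsStrictOrderedRing K] {s : Multiset K} {a b : K} (hab : a < b) (ha : a ∉ s) (hb : b ∉ s) :
    0 < (-1) ^ s.countP (· ∈ Set.Ioo a b) *
      ((s.map fun c => a - c).prod * (s.map fun c => b - c).prod) := by
  induction s using Multiset.induction with
  | empty => simp
  | cons c s ih =>
    simp only [Multiset.mem_cons, not_or] at ha hb
    have hc : 0 < (-1 : K) ^ (if c ∈ Set.Ioo a b then 1 else 0) * ((a - c) * (b - c)) := by
      split_ifs with h
      · simpa using mul_neg_of_neg_of_pos (sub_neg.2 h.1) (sub_pos.2 h.2)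
      · rw [pow_zero, one_mul]
        obtain hca | hac := lt_or_gt_of_ne (Ne.symm ha.1)
        · exact mul_pos (sub_pos.2 hca) (sub_pos.2 (hca.trans hab))
        · have hbc : b < c := lt_of_le_of_ne (not_lt.1 fun hcb => h ⟨hac, hcb⟩) hb.1
          exact mul_pos_of_neg_of_neg (sub_neg.2 hac) (sub_neg.2 hbc)
    refine (mul_pos hc (ih ha.2 hb.2)).trans_eq ?_
    rw [Multiset.countP_cons, Multiset.map_cons, Multiset.map_cons, Multiset.prod_cons,
      Multiset.prod_cons, pow_add]
    ring

theorem neg_one_pow_countP_Ioo_mul_eval_mul_eval_pos {q : ℝ[X]} {a b : ℝ} (hab : a < b)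
    (ha : q.eval a ≠ 0) (hb : q.eval b ≠ 0) :
    0 < (-1) ^ q.roots.countP (· ∈ Set.Ioo a b) * (q.eval a * q.eval b) := by
  have hq : q ≠ 0 := by
    rintro rfl
    simp at ha
  obtain ⟨g, hg, -, hgroots⟩ := exists_prod_multiset_X_sub_C_mul q
  have hg0 : g ≠ 0 := right_ne_zero_of_mul (hg.trans_ne hq)
  have hgroot (t : ℝ) : g.eval t ≠ 0 := fun ht => by
    simpa [hgroots] using (mem_roots hg0).2 ht
  have heval (t : ℝ) : q.eval t = (q.roots.map fun c => t - c).prod * g.eval t := by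
    conv_lhs => rw [← hg]
    simp [eval_multiset_prod]
  refine (mul_pos (neg_one_pow_countP_Ioo_mul_prod_sub_mul_prod_sub_pos hab
    (s := q.roots) (by simpa [hq]) (by simpa [hq]))
    (eval_mul_eval_pos_of_forall_ne_zero hgroot a b)).trans_eq ?_
  rw [heval a, heval b]
  ring

end RealPolynomials

section Rank

variable {ι : Type*} [Fintype ι] [DecidableEq ι] {K : Type*} [Field K]

theorem pow_card_dvd_det {R : Type*} [CommRing R] {M : Matrix ι ι R} {s : R} {F : Finset ι}
    (h : ∀ i ∈ F, ∀ j, s ∣ M i j) : s ^ F.card ∣ M.det := by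
  choose! N hN using h
  have hM : M = Matrix.of fun i j =>
      (if i ∈ F then s else 1) * (if i ∈ F then N i j else M i j) := by
    ext i j
    by_cases hi : i ∈ F <;> simp [hi, hN]
  have hprod : ∏ i, (if i ∈ F then s else 1) = s ^ F.card := by
    rw [Finset.prod_ite_mem, Finset.univ_inter, Finset.prod_const]
  rw [hM]
  exact hprod ▸ (Dvd.intro _ (Matrix.det_mul_column (fun i => if i ∈ F then s else 1)
    (Matrix.of fun i j => if i ∈ F then N i j else M i j)).symm)

theorem pow_dvd_det_smul_sub_map {R : Type*} [CommRing R] [Algebra K R]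
    (D : Matrix ι ι K) (s : R) (N : Matrix ι ι R) :
    s ^ (Fintype.card ι - D.rank) ∣ (s • N - D.map (algebraMap K R)).det := by
  obtain ⟨V, U, e, hV, hU, h⟩ := D.exists_rank_normal_form
  let f := (algebraMap K R).mapMatrix (m := ι)
  have hdet {W : Matrix ι ι K} (hW : IsUnit W) : IsUnit (f W).det :=
    (Matrix.isUnit_iff_isUnit_det _).1 (hW.map f)
  let F : Finset ι := Finset.univ.map (Function.Embedding.inr.trans e.symm.toEmbedding)
  have hF : F.card = Fintype.card ι - D.rank := by simp [F]
  have hrow : ∀ i ∈ F, ∀ j, s ∣ (f V * (s • N - f D) * f U) i j := by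
    intro i hi j
    have hzero : (V * D * U) i j = 0 := by
      obtain ⟨k, -, rfl⟩ := Finset.mem_map.1 hi
      cases hj : e j <;> simp [h, hj]
    have hsplit : f V * (s • N - f D) * f U = s • (f V * N * f U) - f (V * D * U) := by
      simp only [mul_sub, sub_mul, map_mul, Matrix.mul_smul, Matrix.smul_mul]
    rw [hsplit, Matrix.sub_apply, Matrix.smul_apply, smul_eq_mul]
    simp [f, hzero]
  have hdvd := pow_card_dvd_det hrow
  rwa [hF, Matrix.det_mul, Matrix.det_mul, (hdet hU).dvd_mul_right, (hdet hV).dvd_mul_left] at hdvd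

theorem X_pow_dvd_charpoly (M : Matrix ι ι K) :
    (X : K[X]) ^ (Fintype.card ι - M.rank) ∣ M.charpoly := by
  simpa [Matrix.charpoly, Matrix.charmatrix, Matrix.smul_one_eq_diagonal] using
    pow_dvd_det_smul_sub_map M (X : K[X]) 1

theorem natDegree_coeff_charpoly_le {R : Type*} [CommRing R] {M : Matrix ι ι R[X]} {d : ℕ}
    (hM : ∀ i j, (M i j).natDegree ≤ d) {k : ℕ} (hk : k ≤ Fintype.card ι) :
    (M.charpoly.coeff k).natDegree ≤ (Fintype.card ι - k) * d := by
  have huniv : ((Matrix.charpoly.univ R ι).coeff k).totalDegree ≤ Fintype.card ι - k :=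
    (Matrix.charpoly.univ_coeff_isHomogeneous R ι k _ (by omega)).totalDegree_le
  have hcoeff := Matrix.charpoly.univ_coeff_eval₂Hom ι Polynomial.C (fun ij => M ij.1 ij.2) k
  exact (congrArg natDegree hcoeff).symm.le.trans
    (MvPolynomial.aeval_natDegree_le _ huniv _ fun ij => hM ij.1 ij.2)

end Rank

theorem eventually_rank_le_rank_add_smul {ι K : Type*} [Fintype ι] [Field K]
    (A B : Matrix ι ι K) :
    ∀ᶠ s : K in cofinite, A.rank ≤ (A + s • B).rank := by
  classical
  obtain ⟨V, U, e, -, -, h⟩ := Matrix.exists_rank_normal_form A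
  let i : Fin A.rank → ι := fun x => e.symm (Sum.inl x)
  let C : Matrix (Fin A.rank) (Fin A.rank) K := (V * B * U).submatrix i i
  have hsub (s : K) : (V * (A + s • B) * U).submatrix i i = 1 + s • C := by
    ext x y
    simp [C, mul_add, add_mul, h, i, Matrix.one_apply]
  let p : K[X] := (1 + (X : K[X]) • C.map Polynomial.C).det
  have hp (s : K) : p.eval s = (1 + s • C).det := by
    rw [← coe_evalRingHom, RingHom.map_det]
    congr 1
    ext i j
    simp [Matrix.one_apply, apply_ite (eval s), mul_comm s]
  have hp0 : p ≠ 0 := fun h0 => by simpa [h0] using hp 0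
  filter_upwards [(finite_setOfPred_isRoot hp0).compl_mem_cofinite] with s hs
  have hunit : ((V * (A + s • B) * U).submatrix i i).det ≠ 0 := by
    rwa [hsub, ← hp]
  calc A.rank = ((V * (A + s • B) * U).submatrix i i).rank := by
        rw [Matrix.rank_of_det_ne_zero hunit, Fintype.card_fin]
    _ ≤ (V * (A + s • B) * U).rank := Matrix.rank_submatrix_le _ _ _
    _ ≤ (V * (A + s • B)).rank := Matrix.rank_mul_le_left _ _
    _ ≤ (A + s • B).rank := Matrix.rank_mul_le_right _ _

section Inertia

theorem eventually_posDef {𝕜 ι : Type*} [RCLike 𝕜] [Finite ι] {M : Matrix ι ι 𝕜}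
    (hM : M.PosDef) : ∀ᶠ N in 𝓝 M, N.IsHermitian → N.PosDef := by
  have := Fintype.ofFinite ι
  have hsphere : ∀ᶠ N in 𝓝 M, ∀ x ∈ Metric.sphere (0 : ι → 𝕜) 1,
      0 < RCLike.re (star x ⬝ᵥ N *ᵥ x) := by
    refine (isCompact_sphere 0 1).eventually_forall_of_forall_eventually fun x hx => ?_
    have hx0 : x ≠ 0 := ne_zero_of_mem_unit_sphere ⟨x, hx⟩
    have hcont : Continuous fun y : Matrix ι ι 𝕜 × (ι → 𝕜) =>
        RCLike.re (star y.2 ⬝ᵥ y.1 *ᵥ y.2) := by fun_prop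
    exact (isOpen_lt continuous_const hcont).mem_nhds (hM.re_dotProduct_pos hx0)
  filter_upwards [hsphere] with N hN hH
  refine .of_dotProduct_mulVec_pos hH fun x hx => ?_
  have hnorm : (0 : ℝ) < ‖x‖ := norm_pos_iff.2 hx
  have hunit := hN (((‖x‖⁻¹ : ℝ) : 𝕜) • x) (by simp [norm_smul, hnorm.ne'])
  have hre : 0 < RCLike.re (star x ⬝ᵥ N *ᵥ x) := by
    simp only [star_smul, mulVec_smul, smul_dotProduct, dotProduct_smul, smul_eq_mul,
      ← mul_assoc, RCLike.star_def, RCLike.conj_ofReal, ← RCLike.ofReal_mul,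
      RCLike.re_ofReal_mul] at hunit
    exact pos_of_mul_pos_right hunit (by positivity)
  exact RCLike.pos_iff.2 ⟨hre, hH.im_star_dotProduct_mulVec_self x⟩

variable {n : ℕ} {M : Matrix (Fin n) (Fin n) ℂ}

theorem eq_mul_diagonal_mul_conjTranspose (hM : M.IsHermitian) :
    M = (hM.eigenvectorUnitary : Matrix (Fin n) (Fin n) ℂ) *
      diagonal (fun i => (hM.eigenvalues i : ℂ)) *
        (hM.eigenvectorUnitary : Matrix (Fin n) (Fin n) ℂ)ᴴ :=
  hM.spectral_theorem

theorem star_dotProduct_mulVec_eq_sum (hM : M.IsHermitian) (x : Fin n → ℂ) :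
    star x ⬝ᵥ M *ᵥ x = ((∑ i, hM.eigenvalues i *
      ‖((hM.eigenvectorUnitary : Matrix (Fin n) (Fin n) ℂ)ᴴ *ᵥ x) i‖ ^ 2 : ℝ) : ℂ) := by
  set y := (hM.eigenvectorUnitary : Matrix (Fin n) (Fin n) ℂ)ᴴ *ᵥ x with hy
  have hform : star x ⬝ᵥ M *ᵥ x = star y ⬝ᵥ diagonal (fun i => (hM.eigenvalues i : ℂ)) *ᵥ y := by
    conv_lhs => rw [eq_mul_diagonal_mul_conjTranspose hM]
    simp only [hy, star_mulVec, dotProduct_mulVec, vecMul_vecMul, conjTranspose_conjTranspose,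
      Matrix.mul_assoc]
  rw [hform, dotProduct, Complex.ofReal_sum]
  refine Finset.sum_congr rfl fun i _ => ?_
  rw [mulVec_diagonal, Pi.star_apply, Complex.star_def, mul_left_comm, Complex.conj_mul']
  push_cast
  rfl

theorem card_le_nPos_of_posDef {ι : Type*} [Fintype ι] (hM : M.IsHermitian)
    {P : Matrix (Fin n) ι ℂ} (hP : (Pᴴ * M * P).PosDef) : Fintype.card ι ≤ nPos hM := by
  let V : Matrix (Fin n) (Fin n) ℂ := (hM.eigenvectorUnitary : Matrix (Fin n) (Fin n) ℂ)ᴴ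
  let L : (ι → ℂ) →ₗ[ℂ] ({i // 0 < hM.eigenvalues i} → ℂ) :=
    ((V * P).submatrix Subtype.val id).mulVecLin
  have hL : Function.Injective L := by
    rw [← LinearMap.ker_eq_bot, LinearMap.ker_eq_bot']
    intro x hx
    by_contra hx0
    have hpos : 0 < star (P *ᵥ x) ⬝ᵥ M *ᵥ (P *ᵥ x) := by
      simpa [star_mulVec, dotProduct_mulVec, vecMul_vecMul, Matrix.mul_assoc] using
        hP.dotProduct_mulVec_pos hx0
    rw [star_dotProduct_mulVec_eq_sum hM, Complex.zero_lt_real] at hpos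
    refine hpos.not_ge (Finset.sum_nonpos fun i _ => ?_)
    by_cases hi : 0 < hM.eigenvalues i
    · have hzero : (V *ᵥ (P *ᵥ x)) i = 0 := by
        rw [Matrix.mulVec_mulVec]
        exact congrFun hx ⟨i, hi⟩
      simp [V, hzero]
    · exact mul_nonpos_of_nonpos_of_nonneg (not_lt.1 hi) (sq_nonneg _)
  simpa [nPos, Fintype.card_subtype] using LinearMap.finrank_le_finrank_of_injective hL

theorem exists_posDef_conjTranspose_mul_mul (hM : M.IsHermitian) :
    ∃ P : Matrix (Fin n) {i // 0 < hM.eigenvalues i} ℂ, (Pᴴ * M * P).PosDef := by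
  let U : Matrix (Fin n) (Fin n) ℂ := hM.eigenvectorUnitary
  have hU : Uᴴ * U = 1 := Unitary.coe_star_mul_self hM.eigenvectorUnitary
  have hdiag : Uᴴ * M * U = diagonal fun i => (hM.eigenvalues i : ℂ) := by
    conv_lhs => rw [eq_mul_diagonal_mul_conjTranspose hM]
    simp only [U, ← Matrix.mul_assoc] at hU ⊢
    rw [hU, Matrix.one_mul, Matrix.mul_assoc, hU, Matrix.mul_one]
  let e : {i // 0 < hM.eigenvalues i} → Fin n := Subtype.val
  refine ⟨U.submatrix id e, ?_⟩
  have hsub : (U.submatrix id e)ᴴ * M * U.submatrix id e = (Uᴴ * M * U).submatrix e e := rfl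
  rw [hsub, hdiag, submatrix_diagonal _ _ Subtype.val_injective]
  exact PosDef.diagonal fun i => Complex.zero_lt_real.2 i.2

theorem eventually_nPos_le {X : Type*} {l : Filter X} {N : X → Matrix (Fin n) (Fin n) ℂ}
    (hM : M.IsHermitian) (hN : ∀ x, (N x).IsHermitian) (hlim : Tendsto N l (𝓝 M)) :
    ∀ᶠ x in l, nPos hM ≤ nPos (hN x) := by
  obtain ⟨P, hP⟩ := exists_posDef_conjTranspose_mul_mul hM
  have hlim' : Tendsto (fun x => Pᴴ * N x * P) l (𝓝 (Pᴴ * M * P)) :=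
    (((continuous_const.matrix_mul continuous_id).matrix_mul continuous_const).tendsto M).comp hlim
  filter_upwards [hlim'.eventually (eventually_posDef hP)] with x hx
  have := card_le_nPos_of_posDef (hN x)
    (hx (Matrix.isHermitian_conjTranspose_mul_mul P (hN x)))
  simpa [nPos, Fintype.card_subtype] using this

theorem nPos_eq_card_of_eq_smul (hM : M.IsHermitian) {N : Matrix (Fin n) (Fin n) ℂ}
    (hN : N.IsHermitian) {c : ℝ} (hNM : N = (c : ℂ) • M) :
    nPos hN = (Finset.univ.filter fun i => 0 < c * hM.eigenvalues i).card := by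
  have hchar : N.charpoly = ∏ i, (X - C ((c * hM.eigenvalues i : ℝ) : ℂ)) := by
    have hU := Unitary.coe_star_mul_self hM.eigenvectorUnitary
    rw [star_eq_conjTranspose] at hU
    rw [hNM]
    conv_lhs => rw [eq_mul_diagonal_mul_conjTranspose hM]
    rw [← Matrix.smul_mul, charpoly_mul_comm, ← Matrix.mul_smul, ← Matrix.mul_assoc, hU,
      Matrix.one_mul, ← diagonal_smul, charpoly_diagonal]
    simp
  have hroots : Finset.univ.val.map (fun i => (hN.eigenvalues i : ℂ)) =
      Finset.univ.val.map fun i => ((c * hM.eigenvalues i : ℝ) : ℂ) := by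
    refine hN.roots_charpoly_eq_eigenvalues.symm.trans ?_
    rw [hchar, roots_prod _ _ (Finset.prod_ne_zero_iff.2 fun _ _ => X_sub_C_ne_zero _)]
    simp only [roots_X_sub_C, Multiset.bind_singleton]
  have hcount := congrArg (Multiset.countP fun z : ℂ => 0 < z.re) hroots
  simp only [Multiset.countP_map, Complex.ofReal_re] at hcount
  exact hcount

theorem nPos_eq_of_eq_smul (hM : M.IsHermitian) {N : Matrix (Fin n) (Fin n) ℂ}
    (hN : N.IsHermitian) {c : ℝ} (hc : 0 < c) (hNM : N = (c : ℂ) • M) : nPos hN = nPos hM := by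
  rw [nPos_eq_card_of_eq_smul hM hN hNM, nPos]
  simp only [mul_pos_iff_of_pos_left hc]

theorem nPos_neg (hM : M.IsHermitian) : nPos hM.neg = nNeg hM := by
  simp only [nPos_eq_card_of_eq_smul hM hM.neg (c := -1) (by simp), neg_one_mul, neg_pos, nNeg]

theorem nPos_add_nNeg (hM : M.IsHermitian) : nPos hM + nNeg hM = M.rank := by
  rw [hM.rank_eq_card_non_zero_eigs, Fintype.card_subtype, nPos, nNeg,
    ← Finset.card_union_of_disjoint]
  · congr 1
    ext i
    simpa using ne_iff_gt_or_lt.symm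
  · rw [Finset.disjoint_filter]
    exact fun i _ h => not_lt_of_gt h

theorem charpoly_eq_X_pow_mul_prod (hM : M.IsHermitian) :
    M.charpoly = X ^ (n - M.rank) *
      ∏ i with hM.eigenvalues i ≠ 0, (X - C (hM.eigenvalues i : ℂ)) := by
  have hcard : (Finset.univ.filter fun i => ¬ hM.eigenvalues i ≠ 0).card = n - M.rank := by
    rw [hM.rank_eq_card_non_zero_eigs, Finset.filter_not,
      Finset.card_sdiff_of_subset (Finset.filter_subset _ _), Fintype.card_subtype,
      Finset.card_univ, Fintype.card_fin]
  have hzero : ∏ i with ¬ hM.eigenvalues i ≠ 0, (X - C (hM.eigenvalues i : ℂ)) =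
      (X : ℂ[X]) ^ (n - M.rank) := by
    rw [← hcard]
    refine Finset.prod_eq_pow_card fun i hi => ?_
    simp [not_not.1 (Finset.mem_filter.1 hi).2]
  rw [hM.charpoly_eq, ← hzero, mul_comm, Finset.prod_filter_mul_prod_filter_not]
  rfl

theorem exists_coeff_charpoly_eq_neg_one_pow_nPos_mul (hM : M.IsHermitian) :
    ∃ c : ℝ, 0 < c ∧ M.charpoly.coeff (n - M.rank) = (-1) ^ nPos hM * (c : ℂ) := by
  refine ⟨∏ i with hM.eigenvalues i ≠ 0, |hM.eigenvalues i|,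
    Finset.prod_pos fun i hi => abs_pos.2 (Finset.mem_filter.1 hi).2, ?_⟩
  have hnPos : nPos hM =
      ((Finset.univ.filter fun i => hM.eigenvalues i ≠ 0).filter
        fun i => 0 < hM.eigenvalues i).card := by
    rw [nPos, Finset.filter_filter]
    congr 1
    ext i
    simpa using fun h : 0 < hM.eigenvalues i => h.ne'
  rw [charpoly_eq_X_pow_mul_prod hM, coeff_X_pow_mul', if_pos le_rfl, Nat.sub_self,
    coeff_zero_eq_eval_zero, eval_prod, hnPos, ← Finset.prod_const,
    Finset.prod_filter (fun i => 0 < hM.eigenvalues i), Complex.ofReal_prod,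
    ← Finset.prod_mul_distrib]
  refine Finset.prod_congr rfl fun i _ => ?_
  split_ifs with h
  · simp [abs_of_pos h]
  · simp [abs_of_nonpos (not_lt.1 h)]

theorem eventually_nPos_le_nPos_of_eq_add_smul {A C : Matrix (Fin n) (Fin n) ℂ}
    (hC : C.IsHermitian) {N : ℝ → Matrix (Fin n) (Fin n) ℂ} (hN : ∀ t, (N t).IsHermitian)
    (hNt : ∀ t, N t = A + (t : ℂ) • C) : ∀ᶠ t in atTop, nPos hC ≤ nPos (hN t) := by
  have hscaled (t : ℝ) : (((t⁻¹ : ℝ) : ℂ) • N t).IsHermitian :=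
    (hN t).smul (Complex.conj_ofReal _)
  have hlim : Tendsto (fun t : ℝ => ((t⁻¹ : ℝ) : ℂ) • N t) atTop (𝓝 C) := by
    have hinv := (Complex.continuous_ofReal.tendsto _).comp tendsto_inv_atTop_zero
    have hsum : Tendsto (fun t : ℝ => ((t⁻¹ : ℝ) : ℂ) • A + C) atTop (𝓝 C) := by
      simpa using (hinv.smul_const A).add_const C
    refine hsum.congr' ?_
    filter_upwards [eventually_ne_atTop 0] with t ht
    rw [hNt, smul_add, smul_smul, ← Complex.ofReal_mul, inv_mul_cancel₀ ht, Complex.ofReal_one,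
      one_smul]
  filter_upwards [eventually_nPos_le hC hscaled hlim, eventually_gt_atTop 0] with t hle ht
  rwa [nPos_eq_of_eq_smul (hN t) (hscaled t) (inv_pos.2 ht) rfl] at hle

end Inertia

section Pencil

variable {n : ℕ} (A B : Matrix (Fin n) (Fin n) ℂ)

theorem bddAbove_range_rank_pencilAt : BddAbove (Set.range fun z => (pencilAt A B z).rank) :=
  ⟨n, Set.forall_mem_range.2 fun _ => rank_le_width _⟩

theorem rank_pencilAt_le_normalRank (z : OnePoint ℂ) : (pencilAt A B z).rank ≤ normalRank A B :=
  le_ciSup (bddAbove_range_rank_pencilAt A B) z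

theorem exists_rank_pencilAt_eq_normalRank : ∃ z, (pencilAt A B z).rank = normalRank A B :=
  Nat.sSup_mem (Set.range_nonempty _) (bddAbove_range_rank_pencilAt A B)

theorem normalRank_le : normalRank A B ≤ n := by
  obtain ⟨z, hz⟩ := exists_rank_pencilAt_eq_normalRank A B
  exact hz ▸ rank_le_width _

theorem rank_sub_smul_le_normalRank (z : ℂ) : (A - z • B).rank ≤ normalRank A B :=
  rank_pencilAt_le_normalRank A B z

variable {A B} in
theorem rank_sub_smul_eq_normalRank {z : ℂ} (hz : ¬ IsPencilEigenvalue A B (z : OnePoint ℂ)) :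
    (A - z • B).rank = normalRank A B :=
  (rank_sub_smul_le_normalRank A B z).antisymm (not_lt.1 hz)

variable {A B} in
theorem geomMult_eq_zero {z : OnePoint ℂ} (hz : ¬ IsPencilEigenvalue A B z) :
    geomMult A B z = 0 :=
  Nat.sub_eq_zero_of_le (not_lt.1 hz)

theorem exists_real_not_isPencilEigenvalue :
    ∃ t : ℝ, ¬ IsPencilEigenvalue A B ((t : ℂ) : OnePoint ℂ) := by
  obtain ⟨z, hz⟩ := exists_rank_pencilAt_eq_normalRank A B
  simp only [IsPencilEigenvalue, not_lt, ← hz]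
  induction z using OnePoint.rec with
  | infty =>
    have hinj : Function.Injective fun t : ℝ => -(t : ℂ)⁻¹ := fun s t h => by simpa using h
    obtain ⟨t, ht, ht0⟩ := ((hinj.tendsto_cofinite.eventually
      (eventually_rank_le_rank_add_smul B A)).and
        (Set.finite_singleton 0).compl_mem_cofinite).exists
    have ht0 : (t : ℂ) ≠ 0 := Complex.ofReal_ne_zero.2 ht0
    have hscale : A - (t : ℂ) • B = (-(t : ℂ)) • (B + (-(t : ℂ)⁻¹) • A) := by
      rw [smul_add, smul_smul, neg_mul_neg, mul_inv_cancel₀ ht0, one_smul, neg_smul,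
        neg_add_eq_sub]
    refine ⟨t, ht.trans_eq ?_⟩
    change _ = (A - (t : ℂ) • B).rank
    rw [hscale, rank_smul_of_mem_nonZeroDivisors _
      (mem_nonZeroDivisors_of_ne_zero (neg_ne_zero.2 ht0))]
  | coe z =>
    have hinj : Function.Injective fun t : ℝ => z - (t : ℂ) := fun s t h => by simpa using h
    obtain ⟨t, ht⟩ := (hinj.tendsto_cofinite.eventually
      (eventually_rank_le_rank_add_smul (A - z • B) B)).exists
    refine ⟨t, ht.trans_eq ?_⟩
    rw [sub_smul, sub_add_sub_cancel]
    rfl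

theorem eval_coeff_charpoly_pencilMatrix (z : ℂ) (j : ℕ) :
    ((pencilMatrix A B).charpoly.coeff j).eval z = (A - z • B).charpoly.coeff j := by
  have hmap : (pencilMatrix A B).map (evalRingHom z) = A - z • B := by
    ext i j
    simp [pencilMatrix, mul_comm z]
  rw [← hmap, charpoly_map, coeff_map, coe_evalRingHom]

theorem coeff_charpoly_pencilMatrix_eq_zero {j : ℕ} (hj : j < n - normalRank A B) :
    (pencilMatrix A B).charpoly.coeff j = 0 := by
  refine Polynomial.funext fun z => ?_
  rw [eval_coeff_charpoly_pencilMatrix, eval_zero]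
  refine X_pow_dvd_iff.1 (X_pow_dvd_charpoly (A - z • B)) j ?_
  have := rank_sub_smul_le_normalRank A B z
  rw [Fintype.card_fin]
  omega

theorem natDegree_coeff_charpoly_pencilMatrix_le :
    ((pencilMatrix A B).charpoly.coeff (n - normalRank A B)).natDegree ≤ normalRank A B := by
  have hentries (i j : Fin n) : (pencilMatrix A B i j).natDegree ≤ 1 := by
    simp only [pencilMatrix, Matrix.sub_apply, map_apply, Matrix.smul_apply, smul_eq_mul]
    compute_degree
  have hdeg := natDegree_coeff_charpoly_le hentries (k := n - normalRank A B) (by simp)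
  have hle := normalRank_le A B
  rw [Fintype.card_fin, Nat.sub_sub_self hle, mul_one] at hdeg
  exact hdeg

theorem X_sub_C_pow_geomMult_dvd_coeff_charpoly (z : ℂ) :
    (X - C z) ^ geomMult A B z ∣
      (pencilMatrix A B).charpoly.coeff (n - normalRank A B) := by
  -- Replacing `x` by `(X - z) x` multiplies the coefficient of `x ^ j` by `(X - z) ^ j` and turns
  -- the characteristic matrix into a multiple of `X - z` minus the constant matrix `A - z B`.
  have hsubst : (pencilMatrix A B).charpoly.comp (C (X - C z) * X) =
      (C (X - C z) • ((X : ℂ[X][X]) • 1 + B.map (algebraMap ℂ ℂ[X][X])) -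
        (A - z • B).map (algebraMap ℂ ℂ[X][X])).det := by
    rw [Matrix.charpoly, ← coe_compRingHom_apply, RingHom.map_det]
    congr 1
    ext i j : 1
    by_cases hij : i = j
    · subst hij
      simp [pencilMatrix, Polynomial.algebraMap_apply]
      ring
    · simp [pencilMatrix, Polynomial.algebraMap_apply, hij]
      ring
  have hdvd := pow_dvd_det_smul_sub_map (A - z • B) (C (X - C z))
    ((X : ℂ[X][X]) • 1 + B.map (algebraMap ℂ ℂ[X][X]))
  rw [← hsubst, ← C_pow, C_dvd_iff_dvd_coeff] at hdvd
  have hcoeff := hdvd (n - normalRank A B)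
  have hle := normalRank_le A B
  have hrank := rank_sub_smul_le_normalRank A B z
  have hexp : Fintype.card (Fin n) - (A - z • B).rank =
      geomMult A B z + (n - normalRank A B) := by
    change _ = normalRank A B - (A - z • B).rank + _
    rw [Fintype.card_fin]
    omega
  rw [comp_C_mul_X_coeff, hexp, pow_add] at hcoeff
  exact (mul_dvd_mul_iff_right (pow_ne_zero _ (X_sub_C_ne_zero z))).1 hcoeff

end Pencil

section RealEigenvalues

variable {n : ℕ} {A B : Matrix (Fin n) (Fin n) ℂ}

theorem eval_coeff_normalRank (hA : A.IsHermitian) (hB : B.IsHermitian) {t : ℝ}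
    (ht : ¬ IsPencilEigenvalue A B ((t : ℂ) : OnePoint ℂ)) :
    ∃ c : ℝ, 0 < c ∧ ((pencilMatrix A B).charpoly.coeff (n - normalRank A B)).eval (t : ℂ) =
      (-1) ^ nPos (isHermitian_pencil hA hB t) * (c : ℂ) := by
  obtain ⟨c, hc, hcoeff⟩ :=
    exists_coeff_charpoly_eq_neg_one_pow_nPos_mul (isHermitian_pencil hA hB t)
  rw [← eval_coeff_charpoly_pencilMatrix, rank_sub_smul_eq_normalRank ht] at hcoeff
  exact ⟨c, hc, hcoeff⟩

theorem coeff_normalRank_ne_zero (hA : A.IsHermitian) (hB : B.IsHermitian) :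
    (pencilMatrix A B).charpoly.coeff (n - normalRank A B) ≠ 0 := by
  obtain ⟨t, ht⟩ := exists_real_not_isPencilEigenvalue A B
  obtain ⟨c, hc, heval⟩ := eval_coeff_normalRank hA hB ht
  intro h
  simp [h, hc.ne'] at heval

theorem eigenfunctionProd_eq_coeff (hA : A.IsHermitian) (hB : B.IsHermitian) :
    eigenfunctionProd A B = (pencilMatrix A B).charpoly.coeff (n - normalRank A B) := by
  have hne := coeff_normalRank_ne_zero hA hB
  have hdeg : (pencilMatrix A B).charpoly.natTrailingDegree = n - normalRank A B :=
    le_antisymm (natTrailingDegree_le_of_ne_zero hne)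
      (le_natTrailingDegree (fun h => hne (by rw [h, coeff_zero]))
        fun _ => coeff_charpoly_pencilMatrix_eq_zero A B)
  rw [eigenfunctionProd, trailingCoeff, hdeg]

theorem eigenfunctionProd_ne_zero (hA : A.IsHermitian) (hB : B.IsHermitian) :
    eigenfunctionProd A B ≠ 0 :=
  eigenfunctionProd_eq_coeff hA hB ▸ coeff_normalRank_ne_zero hA hB

theorem geomMult_le_algMult (hA : A.IsHermitian) (hB : B.IsHermitian) (t : ℝ) :
    geomMult A B ((t : ℂ) : OnePoint ℂ) ≤ algMult A B t := by
  rw [algMult, le_rootMultiplicity_iff (eigenfunctionProd_ne_zero hA hB),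
    eigenfunctionProd_eq_coeff hA hB]
  exact X_sub_C_pow_geomMult_dvd_coeff_charpoly A B t

theorem isPencilEigenvalue_iff_isRoot (hA : A.IsHermitian) (hB : B.IsHermitian) {t : ℝ} :
    IsPencilEigenvalue A B ((t : ℂ) : OnePoint ℂ) ↔ (eigenfunctionProd A B).IsRoot (t : ℂ) := by
  refine ⟨fun ht => ?_, fun ht => ?_⟩
  · exact (rootMultiplicity_pos (eigenfunctionProd_ne_zero hA hB)).1
      ((Nat.sub_pos_of_lt ht).trans_le (geomMult_le_algMult hA hB t))
  · by_contra hne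
    obtain ⟨c, hc, heval⟩ := eval_coeff_normalRank hA hB hne
    rw [← eigenfunctionProd_eq_coeff hA hB, ht] at heval
    simp [hc.ne'] at heval

theorem map_conj_eigenfunctionProd (hA : A.IsHermitian) (hB : B.IsHermitian) :
    (eigenfunctionProd A B).map (starRingEnd ℂ) = eigenfunctionProd A B := by
  have hconj : (pencilMatrix A B).map (mapRingHom (starRingEnd ℂ)) = (pencilMatrix A B)ᵀ := by
    ext i j : 1
    simp [pencilMatrix, ← hA.apply j i, ← hB.apply j i]
  have hcoeff := congrArg (fun p => p.coeff (n - normalRank A B))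
    (charpoly_map (pencilMatrix A B) (mapRingHom (starRingEnd ℂ)))
  rw [eigenfunctionProd_eq_coeff hA hB]
  rw [hconj, charpoly_transpose] at hcoeff
  simpa using hcoeff.symm

/-- The polynomial `eigenfunctionProd A B` with its coefficients, real when `A` and `B` are
Hermitian, read off in `ℝ`; its roots are the real eigenvalues of the pencil, repeated according to
their algebraic multiplicities. -/
noncomputable def realEigenfunctionProd (A B : Matrix (Fin n) (Fin n) ℂ) : ℝ[X] :=
  (eigenfunctionProd A B).sum fun k c => monomial k c.re

theorem map_realEigenfunctionProd (hA : A.IsHermitian) (hB : B.IsHermitian) :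
    (realEigenfunctionProd A B).map Complex.ofRealHom = eigenfunctionProd A B := by
  ext k
  have hreal : ((((eigenfunctionProd A B).coeff k).re : ℝ) : ℂ) =
      (eigenfunctionProd A B).coeff k := by
    rw [← Complex.conj_eq_iff_re, ← coeff_map, map_conj_eigenfunctionProd hA hB]
  have hcoeff : (realEigenfunctionProd A B).coeff k = ((eigenfunctionProd A B).coeff k).re := by
    rw [realEigenfunctionProd, sum_def, finsetSum_coeff]
    simp +contextual [coeff_monomial]
  rw [coeff_map, hcoeff, Complex.ofRealHom_eq_coe, hreal]

theorem realEigenfunctionProd_ne_zero (hA : A.IsHermitian) (hB : B.IsHermitian) :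
    realEigenfunctionProd A B ≠ 0 := by
  intro h
  exact eigenfunctionProd_ne_zero hA hB (by simp [← map_realEigenfunctionProd hA hB, h])

theorem ofReal_eval_realEigenfunctionProd (hA : A.IsHermitian) (hB : B.IsHermitian) (t : ℝ) :
    (((realEigenfunctionProd A B).eval t : ℝ) : ℂ) = (eigenfunctionProd A B).eval (t : ℂ) := by
  rw [← map_realEigenfunctionProd hA hB]
  exact (eval_map_apply Complex.ofRealHom t).symm

theorem isPencilEigenvalue_iff_mem_roots (hA : A.IsHermitian) (hB : B.IsHermitian) {t : ℝ} :
    IsPencilEigenvalue A B ((t : ℂ) : OnePoint ℂ) ↔ t ∈ (realEigenfunctionProd A B).roots := by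
  rw [isPencilEigenvalue_iff_isRoot hA hB, mem_roots (realEigenfunctionProd_ne_zero hA hB),
    IsRoot, IsRoot, ← ofReal_eval_realEigenfunctionProd hA hB, Complex.ofReal_eq_zero]

theorem algMult_eq_count_roots (hA : A.IsHermitian) (hB : B.IsHermitian) (t : ℝ) :
    algMult A B t = (realEigenfunctionProd A B).roots.count t := by
  rw [algMult, count_roots, ← map_realEigenfunctionProd hA hB]
  exact (eq_rootMultiplicity_map Complex.ofRealHom.injective t).symm

theorem nEig_eq_countP (hA : A.IsHermitian) (hB : B.IsHermitian) (S : Set ℝ)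
    [DecidablePred (· ∈ S)] :
    nEig A B S = (realEigenfunctionProd A B).roots.countP (· ∈ S) := by
  have hset : {t : ℝ | t ∈ S ∧ IsPencilEigenvalue A B ((t : ℂ) : OnePoint ℂ)} =
      ((realEigenfunctionProd A B).roots.filter (· ∈ S)).toFinset := by
    ext t
    simp only [isPencilEigenvalue_iff_mem_roots hA hB, Finset.mem_coe, Multiset.mem_toFinset,
      Multiset.mem_filter, Set.mem_ofPred_eq, and_comm]
  rw [nEig, hset, finsum_mem_coe_finset, Multiset.countP_eq_card_filter,
    ← Multiset.toFinset_sum_count_eq]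
  refine Finset.sum_congr rfl fun t ht => ?_
  rw [algMult_eq_count_roots hA hB,
    Multiset.count_filter_of_pos (Multiset.mem_filter.1 (Multiset.mem_toFinset.1 ht)).2]

theorem card_roots_realEigenfunctionProd_le (hA : A.IsHermitian) (hB : B.IsHermitian) :
    (realEigenfunctionProd A B).roots.card ≤ normalRank A B := by
  have hdeg := natDegree_coeff_charpoly_pencilMatrix_le A B
  rw [← eigenfunctionProd_eq_coeff hA hB, ← map_realEigenfunctionProd hA hB,
    natDegree_map_eq_of_injective Complex.ofRealHom.injective] at hdeg
  exact (card_roots' _).trans hdeg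

theorem neg_one_pow_nPos_mul_eval_pos (hA : A.IsHermitian) (hB : B.IsHermitian) {t : ℝ}
    (ht : ¬ IsPencilEigenvalue A B ((t : ℂ) : OnePoint ℂ)) :
    0 < (-1) ^ nPos (isHermitian_pencil hA hB t) * (realEigenfunctionProd A B).eval t := by
  obtain ⟨c, hc, heval⟩ := eval_coeff_normalRank hA hB ht
  rw [← eigenfunctionProd_eq_coeff hA hB, ← ofReal_eval_realEigenfunctionProd hA hB] at heval
  have heval' : (realEigenfunctionProd A B).eval t =
      (-1) ^ nPos (isHermitian_pencil hA hB t) * c := by exact_mod_cast heval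
  rwa [heval', ← mul_assoc, ← mul_pow, neg_one_mul, neg_neg, one_pow, one_mul]

end RealEigenvalues

section Counting

variable {n : ℕ} {A B : Matrix (Fin n) (Fin n) ℂ}

theorem eventually_nPos_pencil_atTop (hA : A.IsHermitian) (hB : B.IsHermitian) :
    ∀ᶠ t : ℝ in atTop, nNeg hB ≤ nPos (isHermitian_pencil hA hB t) ∧
      nPos hB ≤ nNeg (isHermitian_pencil hA hB t) := by
  filter_upwards [
    eventually_nPos_le_nPos_of_eq_add_smul (A := A) hB.neg (isHermitian_pencil hA hB)
      fun t => by rw [smul_neg, sub_eq_add_neg],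
    eventually_nPos_le_nPos_of_eq_add_smul (A := -A) hB (fun t => (isHermitian_pencil hA hB t).neg)
      fun t => by rw [neg_sub, sub_eq_neg_add]] with t hpos hneg
  rw [nPos_neg hB] at hpos
  rw [nPos_neg (isHermitian_pencil hA hB t)] at hneg
  exact ⟨hpos, hneg⟩

theorem eventually_nPos_pencil_atBot (hA : A.IsHermitian) (hB : B.IsHermitian) :
    ∀ᶠ t : ℝ in atBot, nPos hB ≤ nPos (isHermitian_pencil hA hB t) ∧
      nNeg hB ≤ nNeg (isHermitian_pencil hA hB t) := by
  rw [← map_neg_atTop, eventually_map]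
  filter_upwards [
    eventually_nPos_le_nPos_of_eq_add_smul (A := A) hB (fun t => isHermitian_pencil hA hB (-t))
      fun t => by simp,
    eventually_nPos_le_nPos_of_eq_add_smul (A := -A) hB.neg
      (fun t => (isHermitian_pencil hA hB (-t)).neg) fun t => by simp [sub_eq_add_neg, add_comm]]
    with t hpos hneg
  rw [nPos_neg hB, nPos_neg (isHermitian_pencil hA hB (-t))] at hneg
  exact ⟨hpos, hneg⟩

theorem nPos_add_nNeg_of_not_isPencilEigenvalue (hA : A.IsHermitian) (hB : B.IsHermitian) {t : ℝ}
    (ht : ¬ IsPencilEigenvalue A B ((t : ℂ) : OnePoint ℂ)) :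
    nPos (isHermitian_pencil hA hB t) + nNeg (isHermitian_pencil hA hB t) = normalRank A B :=
  (nPos_add_nNeg _).trans (rank_sub_smul_eq_normalRank ht)

theorem eventually_nPos_pencil_le_add_algMult (hA : A.IsHermitian) (hB : B.IsHermitian) (c : ℝ) :
    ∀ᶠ t in 𝓝 c, nPos (isHermitian_pencil hA hB c) ≤ nPos (isHermitian_pencil hA hB t) ∧
      nPos (isHermitian_pencil hA hB t) ≤
        nPos (isHermitian_pencil hA hB c) + algMult A B c := by
  have hcont : Continuous fun t : ℝ => A - (t : ℂ) • B := by fun_prop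
  have hgeom : normalRank A B - (A - (c : ℂ) • B).rank ≤ algMult A B c :=
    geomMult_le_algMult hA hB c
  filter_upwards [eventually_nPos_le (isHermitian_pencil hA hB c) (isHermitian_pencil hA hB)
      (hcont.tendsto c),
    eventually_nPos_le (isHermitian_pencil hA hB c).neg (fun t => (isHermitian_pencil hA hB t).neg)
      (hcont.neg.tendsto c)] with t hpos hneg
  rw [nPos_neg (isHermitian_pencil hA hB c), nPos_neg (isHermitian_pencil hA hB t)] at hneg
  have hsum_t := nPos_add_nNeg (isHermitian_pencil hA hB t)
  have hsum_c := nPos_add_nNeg (isHermitian_pencil hA hB c)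
  have hrank := rank_sub_smul_le_normalRank A B t
  omega

theorem abs_nPos_sub_nPos_le_nEig_Ioo (hA : A.IsHermitian) (hB : B.IsHermitian) {a b : ℝ}
    (hab : a < b) (ha : ¬ IsPencilEigenvalue A B ((a : ℂ) : OnePoint ℂ))
    (hb : ¬ IsPencilEigenvalue A B ((b : ℂ) : OnePoint ℂ)) :
    |(nPos (isHermitian_pencil hA hB a) : ℤ) - nPos (isHermitian_pencil hA hB b)| ≤
      nEig A B (Set.Ioo a b) := by
  rw [isPencilEigenvalue_iff_mem_roots hA hB] at ha hb
  rw [nEig_eq_countP hA hB]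
  refine abs_sub_le_countP_Ioo (f := fun t => (nPos (isHermitian_pencil hA hB t) : ℤ))
    (fun c => ?_) hab ha hb
  filter_upwards [eventually_nPos_pencil_le_add_algMult hA hB c] with t ht
  rw [algMult_eq_count_roots hA hB] at ht
  exact_mod_cast ht

theorem even_nEig_Ioo_add_nPos_add_nPos (hA : A.IsHermitian) (hB : B.IsHermitian) {a b : ℝ}
    (hab : a < b) (ha : ¬ IsPencilEigenvalue A B ((a : ℂ) : OnePoint ℂ))
    (hb : ¬ IsPencilEigenvalue A B ((b : ℂ) : OnePoint ℂ)) :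
    Even (nEig A B (Set.Ioo a b) + nPos (isHermitian_pencil hA hB a) +
      nPos (isHermitian_pencil hA hB b)) := by
  have hsa := neg_one_pow_nPos_mul_eval_pos hA hB ha
  have hsb := neg_one_pow_nPos_mul_eval_pos hA hB hb
  have hab' := neg_one_pow_countP_Ioo_mul_eval_mul_eval_pos hab
    (right_ne_zero_of_mul hsa.ne') (right_ne_zero_of_mul hsb.ne')
  rw [← nEig_eq_countP hA hB] at hab'
  by_contra hodd
  refine (mul_pos hab' (mul_pos hsa hsb)).not_ge ?_
  set p := nPos (isHermitian_pencil hA hB a)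
  set m := nPos (isHermitian_pencil hA hB b)
  set x := (realEigenfunctionProd A B).eval a
  set y := (realEigenfunctionProd A B).eval b
  calc (-1) ^ nEig A B (Set.Ioo a b) * (x * y) * ((-1) ^ p * x * ((-1) ^ m * y))
      = (-1) ^ (nEig A B (Set.Ioo a b) + p + m) * (x * y) ^ 2 := by ring
    _ = -(x * y) ^ 2 := by rw [(Nat.not_even_iff_odd.1 hodd).neg_one_pow, neg_one_mul]
    _ ≤ 0 := neg_nonpos.2 (sq_nonneg _)

theorem nEig_le_normalRank (hA : A.IsHermitian) (hB : B.IsHermitian) (S : Set ℝ) :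
    nEig A B S ≤ normalRank A B := by
  classical
  rw [nEig_eq_countP hA hB]
  exact (Multiset.countP_le_card _ _).trans (card_roots_realEigenfunctionProd_le hA hB)

theorem nEig_add_nEig_le_nEig (hA : A.IsHermitian) (hB : B.IsHermitian) {S T U : Set ℝ}
    (hST : Disjoint S T) (hS : S ⊆ U) (hT : T ⊆ U) : nEig A B S + nEig A B T ≤ nEig A B U := by
  classical
  simp only [nEig_eq_countP hA hB, countP_mem_add_countP_mem hST rfl]
  exact countP_mem_le_countP_mem (Set.union_subset hS hT) _

theorem nEig_mono (hA : A.IsHermitian) (hB : B.IsHermitian) {S T : Set ℝ} (hST : S ⊆ T) :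
    nEig A B S ≤ nEig A B T := by
  classical
  simpa only [nEig_eq_countP hA hB] using countP_mem_le_countP_mem hST _

theorem nEig_Ioo_add_nEig_Ioo_add_nEig_Ioo_le (hA : A.IsHermitian) (hB : B.IsHermitian)
    (a d : ℝ) {b c : ℝ} (hbc : b ≤ c) :
    nEig A B (Set.Ioo a b) + nEig A B (Set.Ioo b c) + nEig A B (Set.Ioo c d) ≤
      normalRank A B := by
  have hleft : nEig A B (Set.Ioo a b) + nEig A B (Set.Ioo b c) ≤ nEig A B (Set.Iio c) :=
    nEig_add_nEig_le_nEig hA hB (Set.disjoint_left.2 fun _ hx hy => hx.2.not_gt hy.1)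
      (fun _ hx => hx.2.trans_le hbc) fun _ hx => hx.2
  have hright : nEig A B (Set.Iio c) + nEig A B (Set.Ioo c d) ≤ nEig A B Set.univ :=
    nEig_add_nEig_le_nEig hA hB (Set.disjoint_left.2 fun _ hx hy => hy.1.not_gt hx)
      (Set.subset_univ _) (Set.subset_univ _)
  have := nEig_le_normalRank hA hB Set.univ
  omega

theorem eventually_cofinite_not_isPencilEigenvalue (hA : A.IsHermitian) (hB : B.IsHermitian) :
    ∀ᶠ t : ℝ in cofinite, ¬ IsPencilEigenvalue A B ((t : ℂ) : OnePoint ℂ) := by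
  filter_upwards [(realEigenfunctionProd A B).roots.finite_toSet.compl_mem_cofinite] with t ht
  rwa [isPencilEigenvalue_iff_mem_roots hA hB]

theorem exists_lt_nPos_pencil (hA : A.IsHermitian) (hB : B.IsHermitian) (a : ℝ) :
    ∃ s < a, ¬ IsPencilEigenvalue A B ((s : ℂ) : OnePoint ℂ) ∧
      nPos hB ≤ nPos (isHermitian_pencil hA hB s) ∧
      nPos (isHermitian_pencil hA hB s) + nNeg hB ≤ normalRank A B := by
  obtain ⟨s, ⟨hpos, hneg⟩, hs, hsa⟩ := ((eventually_nPos_pencil_atBot hA hB).and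
    (((eventually_cofinite_not_isPencilEigenvalue hA hB).filter_mono atBot_le_cofinite).and
      (eventually_lt_atBot a))).exists
  have := nPos_add_nNeg_of_not_isPencilEigenvalue hA hB hs
  exact ⟨s, hsa, hs, hpos, by omega⟩

theorem exists_gt_nPos_pencil (hA : A.IsHermitian) (hB : B.IsHermitian) (b : ℝ) :
    ∃ t > b, ¬ IsPencilEigenvalue A B ((t : ℂ) : OnePoint ℂ) ∧
      nNeg hB ≤ nPos (isHermitian_pencil hA hB t) ∧
      nPos (isHermitian_pencil hA hB t) + nPos hB ≤ normalRank A B := by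
  obtain ⟨t, ⟨hpos, hneg⟩, ht, hbt⟩ := ((eventually_nPos_pencil_atTop hA hB).and
    (((eventually_cofinite_not_isPencilEigenvalue hA hB).filter_mono atTop_le_cofinite).and
      (eventually_gt_atTop b))).exists
  have := nPos_add_nNeg_of_not_isPencilEigenvalue hA hB ht
  exact ⟨t, hbt, ht, hpos, by omega⟩

theorem nEig_Ioo_add_two_mul_max_le (hA : A.IsHermitian) (hB : B.IsHermitian) {a b : ℝ}
    (hab : a < b) (ha : ¬ IsPencilEigenvalue A B ((a : ℂ) : OnePoint ℂ))
    (hb : ¬ IsPencilEigenvalue A B ((b : ℂ) : OnePoint ℂ)) :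
    (nEig A B (Set.Ioo a b) : ℤ) + 2 * max (nPos hB) (nNeg hB) ≤
      |(nPos (isHermitian_pencil hA hB a) : ℤ) - nPos (isHermitian_pencil hA hB b)| +
        2 * normalRank A B := by
  obtain ⟨s, hsa, hs, hposs, hnegs⟩ := exists_lt_nPos_pencil hA hB a
  obtain ⟨t, hbt, ht, hnegt, hpost⟩ := exists_gt_nPos_pencil hA hB b
  have hleft := abs_nPos_sub_nPos_le_nEig_Ioo hA hB hsa hs ha
  have hright := abs_nPos_sub_nPos_le_nEig_Ioo hA hB hbt hb ht
  have htotal := nEig_Ioo_add_nEig_Ioo_add_nEig_Ioo_le hA hB s t hab.le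
  have habs := le_abs_self ((nPos (isHermitian_pencil hA hB a) : ℤ) -
    nPos (isHermitian_pencil hA hB b))
  have hneg_abs := neg_abs_le ((nPos (isHermitian_pencil hA hB a) : ℤ) -
    nPos (isHermitian_pencil hA hB b))
  rw [abs_le] at hleft hright
  omega

theorem exists_nEig_Ioo_eq (hA : A.IsHermitian) (hB : B.IsHermitian) {a b : ℝ}
    (hab : a < b) (ha : ¬ IsPencilEigenvalue A B ((a : ℂ) : OnePoint ℂ))
    (hb : ¬ IsPencilEigenvalue A B ((b : ℂ) : OnePoint ℂ)) :
    ∃ h : ℕ, h + max (nPos hB) (nNeg hB) ≤ normalRank A B ∧ (nEig A B (Set.Ioo a b) : ℤ) =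
      |(nPos (isHermitian_pencil hA hB a) : ℤ) - nPos (isHermitian_pencil hA hB b)| + 2 * h := by
  have hlower := abs_nPos_sub_nPos_le_nEig_Ioo hA hB hab ha hb
  have hupper := nEig_Ioo_add_two_mul_max_le hA hB hab ha hb
  have heven := even_nEig_Ioo_add_nPos_add_nPos hA hB hab ha hb
  obtain ⟨h, hh⟩ : Even ((nEig A B (Set.Ioo a b) : ℤ) -
      |(nPos (isHermitian_pencil hA hB a) : ℤ) - nPos (isHermitian_pencil hA hB b)|) := by
    grind
  exact ⟨h.toNat, by omega, by omega⟩

theorem abs_nPos_sub_nNeg_sub_geomMult_infty_le_nEig (hA : A.IsHermitian) (hB : B.IsHermitian) :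
    |(nPos hB : ℤ) - nNeg hB| - geomMult A B OnePoint.infty ≤ nEig A B Set.univ := by
  obtain ⟨s, hs0, hs, hposs, hnegs⟩ := exists_lt_nPos_pencil hA hB 0
  obtain ⟨t, h0t, ht, hnegt, hpost⟩ := exists_gt_nPos_pencil hA hB 0
  have hjump := abs_nPos_sub_nPos_le_nEig_Ioo hA hB (hs0.trans h0t) hs ht
  have hmono := nEig_mono hA hB (Set.subset_univ (Set.Ioo s t))
  have hrank : nPos hB + nNeg hB = B.rank := nPos_add_nNeg hB
  have hgeom : geomMult A B OnePoint.infty = normalRank A B - B.rank := rfl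
  rw [abs_le] at hjump
  rw [hgeom, sub_le_iff_le_add, abs_le]
  omega

theorem theorem4p3_general (hA : A.IsHermitian) (hB : B.IsHermitian) :
    (∀ a b : ℝ, a < b →
      ¬ IsPencilEigenvalue A B ((a : ℂ) : OnePoint ℂ) →
      ¬ IsPencilEigenvalue A B ((b : ℂ) : OnePoint ℂ) →
      ∃ h : ℕ, h + max (nPos hB) (nNeg hB) ≤ normalRank A B ∧
        (nEig A B (Set.Ioo a b) : ℤ) =
          |(nPos (isHermitian_pencil hA hB a) : ℤ) - nPos (isHermitian_pencil hA hB b)| + 2 * h) ∧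
    |(nPos hB : ℤ) - nNeg hB| - geomMult A B OnePoint.infty ≤ nEig A B Set.univ ∧
    nEig A B Set.univ ≤ normalRank A B :=
  ⟨fun _ _ => exists_nEig_Ioo_eq hA hB, abs_nPos_sub_nNeg_sub_geomMult_infty_le_nEig hA hB,
    nEig_le_normalRank hA hB _⟩

end Counting

theorem theorem4p3 {n k : ℕ} (A B : Matrix (Fin n) (Fin n) ℂ)
    (hA : A.IsHermitian) (hB : B.IsHermitian)
    (hk : nPos hB + k = n) (hnk : 2 * k ≤ n) :
    (∀ a b : ℝ, a < b →
      ¬ IsPencilEigenvalue A B ((a : ℂ) : OnePoint ℂ) →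
      ¬ IsPencilEigenvalue A B ((b : ℂ) : OnePoint ℂ) →
      ∃ h : ℕ, h ≤ k ∧
        (nEig A B (Set.Ioo a b) : ℤ) =
          |(nPos (isHermitian_pencil hA hB a) : ℤ) - (nPos (isHermitian_pencil hA hB b) : ℤ)|
            + 2 * (h : ℤ)) ∧
    (|(nPos hB : ℤ) - (nNeg hB : ℤ)| - (geomMult A B OnePoint.infty : ℤ)
        ≤ (nEig A B Set.univ : ℤ)) ∧
    (¬ IsPencilEigenvalue A B OnePoint.infty →
      |(nPos hB : ℤ) - (nNeg hB : ℤ)| ≤ (nEig A B Set.univ : ℤ)) ∧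
    nEig A B Set.univ ≤ n := by
  obtain ⟨hinterval, hlower, hupper⟩ := theorem4p3_general hA hB
  have hr := normalRank_le A B
  refine ⟨fun a b hab ha hb => (hinterval a b hab ha hb).imp fun h hh => ⟨by omega, hh.2⟩, hlower,
    fun hinfty => by simpa [geomMult_eq_zero hinfty] using hlower, hupper.trans hr⟩
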